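/- For a partition $\lambda=(\lambda_1\ge\lambda_2\ge\cdots)$ let $s_\lambda(x_1,\dots,x_n)=\sum_T\prod_i x_i^{\#i\text{'s in }T}$ be the Schur polynomial, the sum being over semistandard Young tableaux $T$ of shape $\lambda$ with entries in $\{1,\dots,n\}$. For partitions $\mu,\lambda$ of the same integer write $\mu\le_D\lambda$ if $\sum_{i=1}^k\mu_i\le\sum_{i=1}^k\lambda_i$ for all $k\ge 1$. A symmetric polynomial $f\in\mathbb C[x_1,\dots,x_n]$, homogeneous of some degree $d$, is *dominated by* $s_\lambda$ if $f=\sum_{\mu\vdash d}c_\mu s_\mu(x_1,\dots,x_n)$ with real $c_\mu\ge 0$ for all $\mu$, with $c_\lambda\ne 0$, and with $c_\mu\neq 0$ only if $\mu\le_D\lambda$. The tropicalization of $f=\sum_{i} c_{i}x^{i}$ (for the trivial valuation) is the formal tropical polynomial $\mathsf{Trop}(f)=\bigoplus_{i:\,c_i\ne0}x_1^{\odot i_1}\odot\cdots\odot x_n^{\odot i_n}$, where $a\oplus b=\max(a,b)$ and $a\odot b=a+b$. Tropical polynomials are considered equal if their equality follows from the semiring axioms and the idempotence $a\oplus a=a$,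 that is, if they are equal as formal polynomials over the max-plus semiring. An arithmetic circuit has inputs that are variables $x_i$ or real constants, gates each performing a single operation $\oplus$ or $\odot$ on inputs or on results of other gates (without cycles), and one output. The *tropical semiring complexity* of a tropical polynomial is the smallest number of gates in a circuit whose output equals it. **Proposition.** (i) For all $n\ge 0$ and all partitions $\lambda$, if $f\in\mathbb C[x_1,\dots,x_n]$ is dominated by $s_\lambda$, then $\mathsf{Trop}(f)=\mathsf{Trop}(s_\lambda(x_1,\dots,x_n))$ as tropical polynomials. (ii) There is an absolute constant $A$ such that, for all $n\ge 0$, all partitions $\lambda$ and all $f\ne 0$ in $\mathbb C[x_1,\dots,x_n]$ dominated by $s_\lambda$, the tropical semiring complexity of $\mathsf{Trop}(f)$ is at most $A\cdot n^2\cdot\lambda_1$. -/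

import Mathlib

open MvPolynomial

noncomputable section

namespace TropicalSchur

/-! ### Schur polynomials -/

/-- Semistandard Young tableaux of shape `mu` with entries in an alphabet of `n` letters
(the letters are `0, …, n - 1`). -/
def BoundedSSYT (n : ℕ) (mu : YoungDiagram) : Type :=
  {T : SemistandardYoungTableau mu // ∀ i j, (i, j) ∈ mu → T i j < n}

instance (n : ℕ) (mu : YoungDiagram) : Finite (BoundedSSYT n mu) := by
  refine Finite.of_injective
    (fun (T : BoundedSSYT n mu) (c : mu.cells) =>
      (⟨T.1 c.1.1 c.1.2, T.2 _ _ ((YoungDiagram.mem_cells _).1 c.2)⟩ : Fin n)) ?_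
  intro T T' h
  refine Subtype.ext (SemistandardYoungTableau.ext fun i j => ?_)
  by_cases hc : (i, j) ∈ mu
  · exact congrArg Fin.val (congrFun h ⟨(i, j), (YoungDiagram.mem_cells _).2 hc⟩)
  · rw [T.1.zeros hc, T'.1.zeros hc]

instance (n : ℕ) (mu : YoungDiagram) : Fintype (BoundedSSYT n mu) := Fintype.ofFinite _

/-- The number of occurrences of the letter `a` in the tableau `T`. -/
def BoundedSSYT.content {n : ℕ} {mu : YoungDiagram} (T : BoundedSSYT n mu) (a : Fin n) : ℕ :=
  (mu.cells.filter fun c => T.1 c.1 c.2 = (a : ℕ)).card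

/-- The Schur polynomial `s_mu(x_1, …, x_n)`, the generating polynomial of the semistandard
tableaux of shape `mu` with entries in an `n`-letter alphabet. -/
def schur (n : ℕ) (mu : YoungDiagram) : MvPolynomial (Fin n) ℂ :=
  ∑ T : BoundedSSYT n mu, ∏ a : Fin n, X a ^ T.content a

/-! ### Dominance -/

/-- Dominance order on partitions of the same size; `mu.rowLen i` is the part `mu_{i+1}`. -/
def DominanceLE (mu lam : YoungDiagram) : Prop :=
  mu.card = lam.card ∧
    ∀ k : ℕ, ∑ i ∈ Finset.range k, mu.rowLen i ≤ ∑ i ∈ Finset.range k, lam.rowLen i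

/-- `f` is dominated by `s_lam`: `f` is a symmetric polynomial, homogeneous of some degree `d`,
with an expansion `f = ∑ c_mu s_mu` over partitions `mu` of `d` in which every `c_mu` is a
nonnegative real, `c_lam ≠ 0`, and `c_mu ≠ 0` only if `mu` is below `lam` in dominance order. -/
def IsDominatedBy {n : ℕ} (f : MvPolynomial (Fin n) ℂ) (lam : YoungDiagram) : Prop :=
  f.IsSymmetric ∧ ∃ d : ℕ, f.IsHomogeneous d ∧ ∃ c : YoungDiagram →₀ ℝ,
    (∀ mu, c mu ≠ 0 → mu.card = d) ∧
    f = ∑ mu ∈ c.support, C (c mu : ℂ) * schur n mu ∧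
    (∀ mu, 0 ≤ c mu) ∧
    c lam ≠ 0 ∧
    ∀ mu, c mu ≠ 0 → DominanceLE mu lam

/-! ### Tropical polynomials -/

/-- The max-plus semiring `ℝ ∪ {-∞}`. Mathlib's `Tropical` is the min-plus convention, so the
order of `ℝ` is reversed; the top element of `WithTop ℝᵒᵈ` is `-∞`. -/
abbrev MaxPlus : Type := Tropical (WithTop ℝᵒᵈ)

/-- A real number as an element of the max-plus semiring. -/
def MaxPlus.ofReal (r : ℝ) : MaxPlus :=
  Tropical.trop ((OrderDual.toDual r : ℝᵒᵈ) : WithTop ℝᵒᵈ)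

theorem MaxPlus.ofReal_add (a b : ℝ) :
    MaxPlus.ofReal a + MaxPlus.ofReal b = MaxPlus.ofReal (max a b) := by
  apply Tropical.untrop_injective
  rw [Tropical.untrop_add]
  simp only [MaxPlus.ofReal, Tropical.untrop_trop]
  rw [toDual_max, WithTop.coe_min]

theorem MaxPlus.ofReal_mul (a b : ℝ) :
    MaxPlus.ofReal a * MaxPlus.ofReal b = MaxPlus.ofReal (a + b) := rfl

/-- Tropical polynomials in `n` variables, as formal polynomials over the max-plus semiring: this
is the free commutative algebra over that semiring, so equality in it is equality provable from
the semiring axioms and the idempotence of addition. -/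
abbrev TropPoly (n : ℕ) : Type := MvPolynomial (Fin n) MaxPlus

/-- Tropicalization with respect to the trivial valuation: the tropical sum of the monomials that
occur in `f`, each with the coefficient `0 ∈ ℝ`, which is the unit of the max-plus semiring. -/
def trop {n : ℕ} (f : MvPolynomial (Fin n) ℂ) : TropPoly n :=
  ∑ m ∈ f.support, monomial m (MaxPlus.ofReal 0)

/-! ### Circuits and complexity -/

/-- What a gate or the output may read when `k` gates are available: a variable, a real constant,
or the result of one of these gates. -/
inductive Wire (n k : ℕ) : Type
  | var (i : Fin n) : Wire n k
  | const (r : ℝ) : Wire n k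
  | gate (j : Fin k) : Wire n k

/-- A gate performs a single tropical addition or a single tropical multiplication. -/
inductive Gate (n k : ℕ) : Type
  | add (a b : Wire n k) : Gate n k
  | mul (a b : Wire n k) : Gate n k

/-- A sequence of `k` gates, each of which reads inputs and earlier gates (results of gates may be
reused any number of times). -/
inductive GateSeq (n : ℕ) : ℕ → Type
  | nil : GateSeq n 0
  | snoc {k : ℕ} (s : GateSeq n k) (g : Gate n k) : GateSeq n (k + 1)

/-- The tropical polynomial carried by a wire, given those computed by the available gates. -/
def Wire.eval {n k : ℕ} (v : Fin k → TropPoly n) : Wire n k → TropPoly n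
  | .var i => X i
  | .const r => C (MaxPlus.ofReal r)
  | .gate j => v j

/-- The tropical polynomial computed by a gate, given those computed by the earlier gates. -/
def Gate.eval {n k : ℕ} (v : Fin k → TropPoly n) : Gate n k → TropPoly n
  | .add a b => a.eval v + b.eval v
  | .mul a b => a.eval v * b.eval v

/-- The tropical polynomials computed by the gates of a sequence. -/
def GateSeq.eval {n : ℕ} : {k : ℕ} → GateSeq n k → (Fin k → TropPoly n)
  | _, .nil => Fin.elim0
  | _, .snoc s g => Fin.snoc (α := fun _ => TropPoly n) s.eval (g.eval s.eval)

/-- An arithmetic circuit in `n` variables over the tropical semiring, with its gates listed in a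
topological order and one output. -/
structure Circuit (n : ℕ) : Type where
  /-- The number of gates. -/
  size : ℕ
  /-- The gates. -/
  gates : GateSeq n size
  /-- The output. -/
  output : Wire n size

/-- The tropical polynomial that a circuit computes. -/
def Circuit.res {n : ℕ} (K : Circuit n) : TropPoly n :=
  K.output.eval K.gates.eval

/-- The tropical semiring complexity of `p`: the smallest number of gates in a circuit that
evaluates `p` (and `⊤` if there is no such circuit). -/
def complexity {n : ℕ} (p : TropPoly n) : ℕ∞ :=
  ⨅ (K : Circuit n) (_ : K.res = p), (K.size : ℕ∞)

end TropicalSchur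

end

/-!
Everything rests on a description of the monomials of `s_lam(x_1, …, x_n)` that makes no reference
to tableaux: `x^alpha` occurs if and only if any `k` of the exponents sum to at most
`lam_1 + ⋯ + lam_k`, and all of them sum to `|lam|` (`IsWeight`,
`isWeight_iff_exists_content`). Necessity holds because a letter occurs at most once in each
column. For sufficiency the largest letter is placed in a horizontal strip that is as low as
possible (`removeStrip`); the partial row sums of what remains are then as large as they can be,
so that the inequalities for the other letters persist (`IsWeight.removeStrip`) and induction on
`n` applies.

The inequalities are visibly monotone in the dominance order. As the coefficients `c_mu` are
nonnegative, nothing cancels in `∑ c_mu s_mu`, so a polynomial dominated by `s_lam` has the same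
monomials as `s_lam` (`IsDominatedBy.support_eq`).

The same inequalities characterize the sums of indicator vectors of sets whose sizes are the column
lengths `lam'_j` (`isWeight_iff_exists_columns`), which are the exponents of the monomials of
`∏_j e_{lam'_j}`. A sum of monomials with unit coefficients in the max-plus semiring depends only
on the set of its monomials, so the tropicalization of `f` is the product of the `lam_1` tropical
elementary symmetric polynomials `e_{lam'_j}` (`IsDominatedBy.trop_eq_prod`). The recursion
`e_{k+1}(s ∪ {a}) = e_{k+1}(s) + x_a e_k(s)` computes all the `e_k(x_1, …, x_n)` together with
`2 n^2` gates (`computable_elemSymm`), and `lam_1` further multiplications give the product.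
-/

noncomputable section

namespace TropicalSchur

/-! ### Partial row sums of a Young diagram -/

theorem sum_rowLen_eq_card_filter (mu : YoungDiagram) (k : ℕ) :
    ∑ i ∈ Finset.range k, mu.rowLen i = (mu.cells.filter fun c => c.1 < k).card := by
  rw [Finset.card_eq_sum_card_fiberwise (f := Prod.fst) (t := Finset.range k)
    (fun c hc => by simpa using (Finset.mem_filter.1 hc).2)]
  refine Finset.sum_congr rfl fun i hi => ?_
  rw [mu.rowLen_eq_card, YoungDiagram.row, Finset.filter_filter]
  congr 1
  ext c
  simp only [Finset.mem_range] at hi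
  simp only [Finset.mem_filter, YoungDiagram.mem_cells]
  grind

theorem snd_lt_rowLen_zero {mu : YoungDiagram} {c : ℕ × ℕ} (hc : c ∈ mu) :
    c.2 < mu.rowLen 0 :=
  YoungDiagram.mem_iff_lt_rowLen.1 (mu.up_left_mem (Nat.zero_le c.1) le_rfl hc)

theorem sum_rowLen_eq_sum_min_colLen (mu : YoungDiagram) (k : ℕ) :
    ∑ i ∈ Finset.range k, mu.rowLen i = ∑ j : Fin (mu.rowLen 0), min k (mu.colLen j) := by
  rw [sum_rowLen_eq_card_filter, Fin.sum_univ_eq_sum_range (fun j => min k (mu.colLen j)),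
    Finset.card_eq_sum_card_fiberwise (f := Prod.snd) (t := Finset.range (mu.rowLen 0))]
  · refine Finset.sum_congr rfl fun j _ => ?_
    rw [← Finset.card_range (min k (mu.colLen j))]
    refine Finset.card_bij (fun c _ => c.1) ?_ ?_ ?_
    · rintro ⟨i, j'⟩ hc
      simp only [Finset.mem_filter, YoungDiagram.mem_cells,
        YoungDiagram.mem_iff_lt_colLen] at hc
      obtain ⟨⟨h1, h2⟩, rfl⟩ := hc
      simp [h1, h2]
    · rintro ⟨i, j'⟩ hc ⟨i', j''⟩ hc' h
      simp only [Finset.mem_filter] at hc hc'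
      grind
    · intro i hi
      simp only [Finset.mem_range, lt_min_iff] at hi
      exact ⟨(i, j), by simp [YoungDiagram.mem_iff_lt_colLen, hi.1, hi.2], rfl⟩
  · intro c hc
    simpa using snd_lt_rowLen_zero ((YoungDiagram.mem_cells _).1 (Finset.mem_filter.1 hc).1)

theorem card_eq_sum_colLen (mu : YoungDiagram) :
    mu.card = ∑ j : Fin (mu.rowLen 0), mu.colLen j := by
  rw [Fin.sum_univ_eq_sum_range (fun j => mu.colLen j), YoungDiagram.card,
    Finset.card_eq_sum_card_fiberwise (f := Prod.snd) (t := Finset.range (mu.rowLen 0))]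
  · exact Finset.sum_congr rfl fun j _ => mu.colLen_eq_card.symm
  · intro c hc
    simpa using snd_lt_rowLen_zero ((YoungDiagram.mem_cells _).1 hc)

theorem sum_rowLen_le_card (mu : YoungDiagram) (k : ℕ) :
    ∑ i ∈ Finset.range k, mu.rowLen i ≤ mu.card := by
  rw [sum_rowLen_eq_card_filter]
  exact Finset.card_filter_le _ _

theorem sum_rowLen_eq_card {mu : YoungDiagram} {k : ℕ} (hk : mu.rowLen k = 0) :
    ∑ i ∈ Finset.range k, mu.rowLen i = mu.card := by
  rw [sum_rowLen_eq_card_filter, YoungDiagram.card, Finset.filter_true_of_mem]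
  rintro ⟨i, j⟩ hc
  rw [YoungDiagram.mem_cells, YoungDiagram.mem_iff_lt_rowLen] at hc
  by_contra! h
  have : mu.rowLen i ≤ mu.rowLen k := mu.rowLen_anti _ _ h
  omega

/-! ### The contents of tableaux of a given shape -/

/-- The exponent vector `alpha` lies in the polytope spanned by the rearrangements of `lam`
(padded to `n` parts): any `k` of its entries sum to at most the first `k` parts of `lam`, and all
of them together sum to the size of `lam`. -/
def IsWeight {n : ℕ} (lam : YoungDiagram) (alpha : Fin n → ℕ) : Prop :=
  ∑ a, alpha a = lam.card ∧
    ∀ S : Finset (Fin n), ∑ a ∈ S, alpha a ≤ ∑ i ∈ Finset.range S.card, lam.rowLen i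

theorem IsWeight.mono {n : ℕ} {mu lam : YoungDiagram} {alpha : Fin n → ℕ}
    (h : IsWeight mu alpha) (hle : DominanceLE mu lam) : IsWeight lam alpha :=
  ⟨h.1.trans hle.1, fun S => (h.2 S).trans (hle.2 _)⟩

/-- A diagram with a weight in `n` letters has at most `n` rows. -/
theorem IsWeight.rowLen_eq_zero {n : ℕ} {lam : YoungDiagram} {alpha : Fin n → ℕ}
    (h : IsWeight lam alpha) : lam.rowLen n = 0 := by
  have h1 := h.2 Finset.univ
  have h2 := sum_rowLen_le_card lam (n + 1)
  rw [Finset.sum_range_succ] at h2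
  rw [h.1, Finset.card_univ, Fintype.card_fin] at h1
  omega

/-- The number of columns that contain the letter `a`, when column `j` has the set of entries
`S j`. -/
def columnWeight {n m : ℕ} (S : Fin m → Finset (Fin n)) (a : Fin n) : ℕ :=
  ∑ j, if a ∈ S j then 1 else 0

theorem isWeight_columnWeight {n : ℕ} {lam : YoungDiagram}
    (S : Fin (lam.rowLen 0) → Finset (Fin n)) (hS : ∀ j, (S j).card = lam.colLen j) :
    IsWeight lam (columnWeight S) := by
  have key : ∀ U : Finset (Fin n), ∑ a ∈ U, columnWeight S a = ∑ j, (U ∩ S j).card := by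
    intro U
    simp only [columnWeight]
    rw [Finset.sum_comm]
    refine Finset.sum_congr rfl fun j _ => ?_
    rw [← Finset.card_filter, Finset.filter_mem_eq_inter]
  constructor
  · rw [key, card_eq_sum_colLen]
    simp [hS]
  · intro U
    rw [key, sum_rowLen_eq_sum_min_colLen]
    refine Finset.sum_le_sum fun j _ => le_min ?_ ?_
    · exact Finset.card_le_card Finset.inter_subset_left
    · rw [← hS]
      exact Finset.card_le_card Finset.inter_subset_right

open Classical in
/-- The set of entries in column `j` of a tableau. -/
def BoundedSSYT.column {n : ℕ} {mu : YoungDiagram} (T : BoundedSSYT n mu) (j : ℕ) :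
    Finset (Fin n) :=
  Finset.univ.filter fun a => ∃ i, (i, j) ∈ mu ∧ T.1 i j = (a : ℕ)

theorem BoundedSSYT.mem_column {n : ℕ} {mu : YoungDiagram} {T : BoundedSSYT n mu} {j : ℕ}
    {a : Fin n} : a ∈ T.column j ↔ ∃ i, (i, j) ∈ mu ∧ T.1 i j = (a : ℕ) := by
  simp [column]

theorem BoundedSSYT.col_injective {n : ℕ} {mu : YoungDiagram} (T : BoundedSSYT n mu)
    {i i' j : ℕ} (h : (i, j) ∈ mu) (h' : (i', j) ∈ mu) (e : T.1 i j = T.1 i' j) : i = i' := by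
  rcases lt_trichotomy i i' with hlt | rfl | hlt
  · exact absurd e (T.1.col_strict hlt h').ne
  · rfl
  · exact absurd e (T.1.col_strict hlt h).ne'

theorem BoundedSSYT.card_column {n : ℕ} {mu : YoungDiagram} (T : BoundedSSYT n mu) (j : ℕ) :
    (T.column j).card = mu.colLen j := by
  rw [← Finset.card_range (mu.colLen j)]
  symm
  refine Finset.card_bij (fun i hi => ⟨T.1 i j, T.2 i j
    (YoungDiagram.mem_iff_lt_colLen.2 (Finset.mem_range.1 hi))⟩) ?_ ?_ ?_
  · intro i hi
    rw [Finset.mem_range, ← YoungDiagram.mem_iff_lt_colLen] at hi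
    simpa [mem_column] using ⟨i, hi, rfl⟩
  · intro i hi i' hi' h
    rw [Finset.mem_range, ← YoungDiagram.mem_iff_lt_colLen] at hi hi'
    exact T.col_injective hi hi' (congrArg Fin.val h)
  · intro a ha
    obtain ⟨i, hi, h⟩ := mem_column.1 ha
    exact ⟨i, by simpa [← YoungDiagram.mem_iff_lt_colLen] using hi, Fin.ext h⟩

theorem BoundedSSYT.content_eq_columnWeight {n : ℕ} {mu : YoungDiagram}
    (T : BoundedSSYT n mu) :
    T.content = columnWeight fun j : Fin (mu.rowLen 0) => T.column j := by
  funext a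
  rw [columnWeight, Fin.sum_univ_eq_sum_range (fun j => if a ∈ T.column j then 1 else 0),
    BoundedSSYT.content,
    Finset.card_eq_sum_card_fiberwise (f := Prod.snd) (t := Finset.range (mu.rowLen 0))]
  · refine Finset.sum_congr rfl fun j _ => ?_
    split_ifs with h
    · obtain ⟨i, hi, he⟩ := mem_column.1 h
      refine Finset.card_eq_one.2 ⟨(i, j), ?_⟩
      ext ⟨i', j'⟩
      simp only [Finset.mem_filter, YoungDiagram.mem_cells, Finset.mem_singleton, Prod.mk.injEq]
      constructor
      · rintro ⟨⟨h1, h2⟩, rfl⟩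
        exact ⟨T.col_injective h1 hi (h2.trans he.symm), rfl⟩
      · rintro ⟨rfl, rfl⟩
        exact ⟨⟨hi, he⟩, rfl⟩
    · rw [Finset.card_eq_zero, Finset.filter_eq_empty_iff]
      rintro ⟨i', j'⟩ hc rfl
      simp only [Finset.mem_filter, YoungDiagram.mem_cells] at hc
      exact h (by simpa [mem_column] using ⟨i', hc⟩)
  · intro c hc
    simpa using snd_lt_rowLen_zero ((YoungDiagram.mem_cells _).1 (Finset.mem_filter.1 hc).1)

/-! ### Tableaux with a prescribed content -/

/-- The length of row `i` after `a` cells, no two of them in the same column, have been removed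
from `lam`, each taken from as low a row as possible: the rows of length less than `a` lose
everything that the interlacing condition `lam_{i+1} ≤ mu_i` permits. -/
def stripLen (lam : YoungDiagram) (a i : ℕ) : ℕ :=
  max (lam.rowLen (i + 1)) (min (lam.rowLen i) (lam.rowLen i + lam.rowLen (i + 1) - a))

theorem stripLen_le (lam : YoungDiagram) (a i : ℕ) : stripLen lam a i ≤ lam.rowLen i := by
  have := lam.rowLen_anti i (i + 1) (Nat.le_succ i)
  unfold stripLen
  omega

theorem rowLen_succ_le_stripLen (lam : YoungDiagram) (a i : ℕ) :
    lam.rowLen (i + 1) ≤ stripLen lam a i :=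
  le_max_left _ _

theorem stripLen_anti (lam : YoungDiagram) (a : ℕ) : Antitone (stripLen lam a) :=
  antitone_nat_of_succ_le fun i =>
    (stripLen_le lam a (i + 1)).trans (rowLen_succ_le_stripLen lam a i)

/-- The diagram `lam` without a lowest possible horizontal strip of `a` cells. -/
def removeStrip (lam : YoungDiagram) (a : ℕ) : YoungDiagram where
  cells := lam.cells.filter fun c => c.2 < stripLen lam a c.1
  isLowerSet := by
    rintro ⟨i, j⟩ ⟨i', j'⟩ hle hc
    obtain ⟨hi, hj⟩ : i' ≤ i ∧ j' ≤ j := hle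
    simp only [Finset.coe_filter, YoungDiagram.mem_cells, Set.mem_ofPred_eq] at hc ⊢
    exact ⟨lam.up_left_mem hi hj hc.1, (hj.trans_lt hc.2).trans_le (stripLen_anti lam a hi)⟩

theorem mem_removeStrip {lam : YoungDiagram} {a i j : ℕ} :
    (i, j) ∈ removeStrip lam a ↔ j < stripLen lam a i := by
  rw [← YoungDiagram.mem_cells]
  simp only [removeStrip, Finset.mem_filter, YoungDiagram.mem_cells,
    YoungDiagram.mem_iff_lt_rowLen, and_iff_right_iff_imp]
  exact fun h => h.trans_le (stripLen_le lam a i)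

theorem rowLen_removeStrip (lam : YoungDiagram) (a i : ℕ) :
    (removeStrip lam a).rowLen i = stripLen lam a i :=
  eq_of_forall_lt_iff fun j => by rw [← YoungDiagram.mem_iff_lt_rowLen, mem_removeStrip]

theorem removeStrip_le (lam : YoungDiagram) (a : ℕ) : removeStrip lam a ≤ lam :=
  YoungDiagram.cells_subset_iff.1 (Finset.filter_subset _ _)

theorem mem_removeStrip_of_lt {lam : YoungDiagram} {a i i' j : ℕ} (hi : i < i')
    (hc : (i', j) ∈ lam) : (i, j) ∈ removeStrip lam a := by
  rw [mem_removeStrip]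
  exact (YoungDiagram.mem_iff_lt_rowLen.1 (lam.up_left_mem hi le_rfl hc)).trans_le
    (rowLen_succ_le_stripLen lam a i)

/-- The first `k` rows of `removeStrip lam a` are as long in total as the interlacing and the
number of removed cells allow. -/
theorem sum_rowLen_removeStrip {lam : YoungDiagram} {a : ℕ} (ha : a ≤ lam.rowLen 0) (k : ℕ) :
    (a ≤ lam.rowLen k → ∑ i ∈ Finset.range k, (removeStrip lam a).rowLen i =
      ∑ i ∈ Finset.range k, lam.rowLen i) ∧
    (lam.rowLen k ≤ a → ∑ i ∈ Finset.range k, (removeStrip lam a).rowLen i + a =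
      ∑ i ∈ Finset.range (k + 1), lam.rowLen i) := by
  simp only [rowLen_removeStrip]
  induction k with
  | zero => simp; omega
  | succ k ih =>
    have := lam.rowLen_anti k (k + 1) (Nat.le_succ k)
    rw [Finset.sum_range_succ _ (k + 1)]
    rw [Finset.sum_range_succ] at ih ⊢
    rw [Finset.sum_range_succ (fun i => lam.rowLen i)]
    unfold stripLen at ih ⊢
    omega

theorem IsWeight.last_le {n : ℕ} {lam : YoungDiagram} {alpha : Fin (n + 1) → ℕ}
    (h : IsWeight lam alpha) : alpha (Fin.last n) ≤ lam.rowLen 0 := by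
  simpa using h.2 {Fin.last n}

/-- A set of letters is tested against the condition of `IsWeight` for `lam` either as it stands
or with the last letter added, according to where the strip begins. -/
theorem IsWeight.removeStrip {n : ℕ} {lam : YoungDiagram} {alpha : Fin (n + 1) → ℕ}
    (h : IsWeight lam alpha) :
    IsWeight (removeStrip lam (alpha (Fin.last n))) (fun a => alpha a.castSucc) ∧
      (TropicalSchur.removeStrip lam (alpha (Fin.last n))).card + alpha (Fin.last n)
        = lam.card := by
  set a := alpha (Fin.last n) with ha
  have hsum := sum_rowLen_removeStrip (a := a) h.last_le
  have hmap : ∀ S : Finset (Fin n),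
      ∑ x ∈ S.map Fin.castSuccEmb, alpha x = ∑ x ∈ S, alpha x.castSucc := by
    intro S
    simp
  have hlast : ∀ S : Finset (Fin n), Fin.last n ∉ S.map Fin.castSuccEmb := by
    intro S
    simp [Fin.castSucc_ne_last]
  have hS : ∀ S : Finset (Fin n), ∑ x ∈ S, alpha x.castSucc ≤
      ∑ i ∈ Finset.range S.card, lam.rowLen i := by
    intro S
    simpa [hmap] using h.2 (S.map Fin.castSuccEmb)
  have hS' : ∀ S : Finset (Fin n), a + ∑ x ∈ S, alpha x.castSucc ≤
      ∑ i ∈ Finset.range (S.card + 1), lam.rowLen i := by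
    intro S
    have := h.2 (insert (Fin.last n) (S.map Fin.castSuccEmb))
    rwa [Finset.sum_insert (hlast S), Finset.card_insert_of_notMem (hlast S), hmap,
      Finset.card_map] at this
  have htot : ∑ x : Fin n, alpha x.castSucc + a = lam.card := by
    rw [← h.1, Fin.sum_univ_castSucc]
  have hzero : lam.rowLen (n + 1) = 0 := h.rowLen_eq_zero
  have hcard := sum_rowLen_eq_card hzero
  have hn : lam.rowLen n ≤ a := by
    have := hS Finset.univ
    rw [Finset.card_univ, Fintype.card_fin] at this
    rw [Finset.sum_range_succ] at hcard
    omega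
  have hzero' : (TropicalSchur.removeStrip lam a).rowLen n = 0 := by
    rw [rowLen_removeStrip, stripLen, hzero]
    omega
  have hcard' := (hsum n).2 hn
  rw [hcard, sum_rowLen_eq_card hzero'] at hcard'
  refine ⟨⟨Nat.add_right_cancel (htot.trans hcard'.symm), fun S => ?_⟩, hcard'⟩
  change ∑ x ∈ S, alpha x.castSucc ≤ _
  rcases le_total a (lam.rowLen S.card) with hle | hle
  · rw [(hsum _).1 hle]
    exact hS S
  · have := (hsum _).2 hle
    have := hS' S
    omega

/-- Extension of a tableau by a horizontal strip filled with a new largest letter. -/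
def BoundedSSYT.extend {n : ℕ} {mu lam : YoungDiagram} (T : BoundedSSYT n mu)
    (hstrip : ∀ i i' j, i < i' → (i', j) ∈ lam → (i, j) ∈ mu) (hle : mu ≤ lam) :
    BoundedSSYT (n + 1) lam where
  val :=
    { entry := fun i j => if (i, j) ∈ mu then T.1 i j else if (i, j) ∈ lam then n else 0
      row_weak' := by
        intro i j1 j2 hj hc
        by_cases h2 : (i, j2) ∈ mu
        · have h1 : (i, j1) ∈ mu := mu.up_left_mem le_rfl hj.le h2
          simp only [h1, h2, if_true]
          exact T.1.row_weak hj h2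
        · simp only [h2, hc, if_true, if_false]
          split_ifs with h
          · exact (T.2 _ _ h).le
          · exact le_rfl
          · exact Nat.zero_le _
      col_strict' := by
        intro i1 i2 j hi hc
        have h1 := hstrip _ _ _ hi hc
        simp only [h1, hc, if_true]
        split_ifs with h
        · exact T.1.col_strict hi h
        · exact T.2 _ _ h1
      zeros' := by
        intro i j hc
        have : (i, j) ∉ mu := fun h => hc (hle h)
        simp [hc, this] }
  property := by
    intro i j hc
    change (if (i, j) ∈ mu then T.1 i j else if (i, j) ∈ lam then n else 0) < n + 1
    split_ifs with h
    · exact (T.2 _ _ h).trans (Nat.lt_succ_self n)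
    · exact Nat.lt_succ_self n

theorem BoundedSSYT.extend_apply {n : ℕ} {mu lam : YoungDiagram} (T : BoundedSSYT n mu)
    (hstrip : ∀ i i' j, i < i' → (i', j) ∈ lam → (i, j) ∈ mu) (hle : mu ≤ lam) (i j : ℕ) :
    (T.extend hstrip hle).1 i j =
      if (i, j) ∈ mu then T.1 i j else if (i, j) ∈ lam then n else 0 :=
  rfl

theorem BoundedSSYT.content_extend_castSucc {n : ℕ} {mu lam : YoungDiagram}
    (T : BoundedSSYT n mu) (hstrip : ∀ i i' j, i < i' → (i', j) ∈ lam → (i, j) ∈ mu)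
    (hle : mu ≤ lam) (a : Fin n) : (T.extend hstrip hle).content a.castSucc = T.content a := by
  rw [BoundedSSYT.content, BoundedSSYT.content]
  congr 1
  ext ⟨i, j⟩
  have ha := a.2
  have hsub : (i, j) ∈ mu → (i, j) ∈ lam := fun h => hle h
  rw [Finset.mem_filter, Finset.mem_filter]
  simp only [YoungDiagram.mem_cells, BoundedSSYT.extend_apply, Fin.val_castSucc]
  grind

theorem BoundedSSYT.content_extend_last {n : ℕ} {mu lam : YoungDiagram}
    (T : BoundedSSYT n mu) (hstrip : ∀ i i' j, i < i' → (i', j) ∈ lam → (i, j) ∈ mu)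
    (hle : mu ≤ lam) : (T.extend hstrip hle).content (Fin.last n) = lam.card - mu.card := by
  rw [BoundedSSYT.content, YoungDiagram.card, YoungDiagram.card,
    ← Finset.card_sdiff_of_subset (YoungDiagram.cells_subset_iff.2 hle)]
  congr 1
  ext ⟨i, j⟩
  have hlt := T.2 i j
  rw [Finset.mem_filter, Finset.mem_sdiff]
  simp only [YoungDiagram.mem_cells, BoundedSSYT.extend_apply, Fin.val_last]
  grind

/-- Every weight is the content of a tableau: the cells of the last letter are a lowest possible
horizontal strip, and induction fills the rest. -/
theorem IsWeight.exists_content_eq : ∀ {n : ℕ} {lam : YoungDiagram} {alpha : Fin n → ℕ},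
    IsWeight lam alpha → ∃ T : BoundedSSYT n lam, T.content = alpha := by
  intro n
  induction n with
  | zero =>
    intro lam alpha h
    refine ⟨⟨default, fun i j hc => ?_⟩, Subsingleton.elim _ _⟩
    have h0 := YoungDiagram.mem_iff_lt_rowLen.1 (lam.up_left_mem (Nat.zero_le i) le_rfl hc)
    rw [h.rowLen_eq_zero] at h0
    exact absurd h0 (Nat.not_lt_zero _)
  | succ n ih =>
    intro lam alpha h
    obtain ⟨hw, hcard⟩ := h.removeStrip
    obtain ⟨T, hT⟩ := ih hw
    refine ⟨T.extend (fun i i' j => mem_removeStrip_of_lt) (removeStrip_le _ _), ?_⟩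
    funext a
    induction a using Fin.lastCases with
    | last =>
      rw [BoundedSSYT.content_extend_last]
      omega
    | cast a =>
      rw [BoundedSSYT.content_extend_castSucc, hT]

theorem isWeight_iff_exists_content {n : ℕ} {lam : YoungDiagram} {alpha : Fin n → ℕ} :
    IsWeight lam alpha ↔ ∃ T : BoundedSSYT n lam, T.content = alpha := by
  refine ⟨IsWeight.exists_content_eq, ?_⟩
  rintro ⟨T, rfl⟩
  rw [T.content_eq_columnWeight]
  exact isWeight_columnWeight _ fun j => T.card_column j

theorem isWeight_iff_exists_columns {n : ℕ} {lam : YoungDiagram} {alpha : Fin n → ℕ} :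
    IsWeight lam alpha ↔ ∃ S : Fin (lam.rowLen 0) → Finset (Fin n),
      (∀ j, (S j).card = lam.colLen j) ∧ columnWeight S = alpha := by
  constructor
  · intro h
    obtain ⟨T, rfl⟩ := h.exists_content_eq
    exact ⟨fun j => T.column j, fun j => T.card_column j, T.content_eq_columnWeight.symm⟩
  · rintro ⟨S, hS, rfl⟩
    exact isWeight_columnWeight S hS

/-! ### Supports of polynomials dominated by a Schur polynomial -/

theorem coeff_schur (n : ℕ) (mu : YoungDiagram) (m : Fin n →₀ ℕ) :
    coeff m (schur n mu) =
      ((Finset.univ.filter fun T : BoundedSSYT n mu => T.content = m).card : ℂ) := by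
  rw [schur, coeff_sum, Finset.card_filter, Nat.cast_sum]
  refine Finset.sum_congr rfl fun T _ => ?_
  have h : ∏ a : Fin n, (X a : MvPolynomial (Fin n) ℂ) ^ T.content a =
      monomial (Finsupp.equivFunOnFinite.symm T.content) 1 := by
    rw [monomial_eq, C_1, one_mul, Finsupp.prod_fintype _ _ fun a => pow_zero _]
    rfl
  rw [h, coeff_monomial, Nat.cast_ite, Nat.cast_one, Nat.cast_zero]
  exact if_congr (Equiv.symm_apply_eq _) rfl rfl

/-- No cancellation occurs between the Schur polynomials in the expansion, and dominance makes the
weights of each of them weights of `lam`. -/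
theorem IsDominatedBy.coeff_ne_zero_iff {n : ℕ} {f : MvPolynomial (Fin n) ℂ}
    {lam : YoungDiagram} (hf : IsDominatedBy f lam) (m : Fin n →₀ ℕ) :
    coeff m f ≠ 0 ↔ IsWeight lam m := by
  obtain ⟨-, d, -, c, -, rfl, hnonneg, hlam, hdom⟩ := hf
  set K : YoungDiagram → ℕ := fun mu =>
    (Finset.univ.filter fun T : BoundedSSYT n mu => T.content = m).card with hK
  have hKpos : ∀ mu, K mu ≠ 0 ↔ IsWeight mu m := by
    intro mu
    rw [isWeight_iff_exists_content, hK, Finset.card_ne_zero, Finset.filter_nonempty_iff]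
    simp
  have hcoeff : coeff m (∑ mu ∈ c.support, C (c mu : ℂ) * schur n mu) =
      ((∑ mu ∈ c.support, c mu * K mu : ℝ) : ℂ) := by
    simp only [coeff_sum, coeff_C_mul, coeff_schur, hK]
    push_cast
    rfl
  rw [hcoeff, Complex.ofReal_ne_zero, Ne, Finset.sum_eq_zero_iff_of_nonneg
    fun mu _ => mul_nonneg (hnonneg mu) (Nat.cast_nonneg _)]
  constructor
  · intro h
    push Not at h
    obtain ⟨mu, hmu, h⟩ := h
    refine IsWeight.mono ((hKpos mu).1 fun h0 => h ?_) (hdom mu (Finsupp.mem_support_iff.1 hmu))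
    rw [h0, Nat.cast_zero, mul_zero]
  · intro h h0
    have := h0 lam (Finsupp.mem_support_iff.2 hlam)
    rw [mul_eq_zero, Nat.cast_eq_zero] at this
    exact this.elim hlam ((hKpos lam).2 h)

theorem coeff_schur_ne_zero_iff {n : ℕ} {lam : YoungDiagram} (m : Fin n →₀ ℕ) :
    coeff m (schur n lam) ≠ 0 ↔ IsWeight lam m := by
  rw [coeff_schur, Nat.cast_ne_zero, isWeight_iff_exists_content, Finset.card_ne_zero,
    Finset.filter_nonempty_iff]
  simp

theorem IsDominatedBy.support_eq {n : ℕ} {f : MvPolynomial (Fin n) ℂ} {lam : YoungDiagram}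
    (hf : IsDominatedBy f lam) : f.support = (schur n lam).support := by
  ext m
  rw [mem_support_iff, mem_support_iff, hf.coeff_ne_zero_iff, coeff_schur_ne_zero_iff]

/-! ### Factorization into elementary symmetric polynomials -/

theorem MaxPlus.ofReal_zero : MaxPlus.ofReal 0 = 1 := rfl

theorem MaxPlus.natCast_eq (k : ℕ) : (k : MaxPlus) = if k = 0 then 0 else 1 := by
  induction k with
  | zero => simp
  | succ k ih =>
    rw [Nat.cast_succ, ih, if_neg (Nat.succ_ne_zero k)]
    split_ifs with h
    · exact zero_add 1
    · exact Tropical.add_self 1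

/-- Addition being idempotent, a tropical sum of monomials depends only on the set of monomials. -/
theorem sum_monomial_eq_sum_monomial {n : ℕ} {ι κ : Type*} {s : Finset ι} {t : Finset κ}
    {g : ι → Fin n →₀ ℕ} {h : κ → Fin n →₀ ℕ}
    (H : ∀ m, (∃ i ∈ s, g i = m) ↔ ∃ j ∈ t, h j = m) :
    (∑ i ∈ s, monomial (g i) 1 : TropPoly n) = ∑ j ∈ t, monomial (h j) 1 := by
  classical
  ext m : 1
  simp only [coeff_sum, coeff_monomial]
  rw [Finset.sum_boole, Finset.sum_boole, MaxPlus.natCast_eq, MaxPlus.natCast_eq]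
  simp only [Finset.card_eq_zero]
  refine if_congr (not_iff_not.1 ?_) rfl rfl
  rw [← Ne, ← Ne, ← Finset.nonempty_iff_ne_empty, ← Finset.nonempty_iff_ne_empty,
    Finset.filter_nonempty_iff, Finset.filter_nonempty_iff]
  exact H m

/-- The tropical elementary symmetric polynomial of degree `k` in the variables indexed by `s`. -/
def elemSymm {n : ℕ} (s : Finset (Fin n)) (k : ℕ) : TropPoly n :=
  ∑ t ∈ s.powersetCard k, ∏ a ∈ t, X a

theorem prod_prod_X_eq_monomial {n m : ℕ} (S : Fin m → Finset (Fin n)) :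
    (∏ j, ∏ a ∈ S j, X a : TropPoly n) =
      monomial (Finsupp.equivFunOnFinite.symm (columnWeight S)) 1 := by
  have h : Finsupp.equivFunOnFinite.symm (columnWeight S) =
      ∑ j, ∑ a ∈ S j, Finsupp.single a 1 := by
    ext a
    simp [columnWeight, Finsupp.finsetSum_apply, Finsupp.single_apply]
  simp only [h, monomial_sum_one, X]

/-- The tropical form of the fact that the product of the `e_{lam'_j}` and `s_lam` have the same
monomials: a weight of `lam` is a sum of indicator vectors of sets with the sizes of the
columns. -/
theorem IsDominatedBy.trop_eq_prod {n : ℕ} {f : MvPolynomial (Fin n) ℂ} {lam : YoungDiagram}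
    (hf : IsDominatedBy f lam) :
    trop f = ∏ j : Fin (lam.rowLen 0), elemSymm Finset.univ (lam.colLen j) := by
  simp only [elemSymm]
  rw [Finset.prod_univ_sum, trop, MaxPlus.ofReal_zero]
  simp only [prod_prod_X_eq_monomial]
  refine sum_monomial_eq_sum_monomial (g := id) fun m => ?_
  simp only [id, exists_eq_right, mem_support_iff, hf.coeff_ne_zero_iff,
    isWeight_iff_exists_columns, Fintype.mem_piFinset, Finset.mem_powersetCard,
    Finset.subset_univ, true_and]
  refine exists_congr fun S => and_congr_right fun _ => ?_
  rw [Equiv.symm_apply_eq]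
  rfl

theorem elemSymm_zero {n : ℕ} (s : Finset (Fin n)) : elemSymm s 0 = 1 := by
  simp [elemSymm]

theorem elemSymm_eq_zero {n : ℕ} {s : Finset (Fin n)} {k : ℕ} (h : s.card < k) :
    elemSymm s k = 0 := by
  rw [elemSymm, Finset.powersetCard_eq_empty.2 h, Finset.sum_empty]

theorem elemSymm_insert_succ {n : ℕ} {s : Finset (Fin n)} {a : Fin n} (ha : a ∉ s) (k : ℕ) :
    elemSymm (insert a s) (k + 1) = elemSymm s (k + 1) + X a * elemSymm s k := by
  have hmem : ∀ {j : ℕ} {t : Finset (Fin n)}, t ∈ s.powersetCard j → a ∉ t := fun ht h =>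
    ha ((Finset.mem_powersetCard.1 ht).1 h)
  rw [elemSymm, Finset.powersetCard_succ_insert ha, Finset.sum_union, Finset.sum_image,
    elemSymm, elemSymm, Finset.mul_sum]
  · congr 1
    exact Finset.sum_congr rfl fun t ht => Finset.prod_insert (hmem ht)
  · intro t ht u hu h
    rw [← Finset.erase_insert (hmem ht), ← Finset.erase_insert (hmem hu)]
    exact congrArg (fun v => v.erase a) h
  · rw [Finset.disjoint_left]
    intro t ht hu
    obtain ⟨u, -, rfl⟩ := Finset.mem_image.1 hu
    exact hmem ht (Finset.mem_insert_self a u)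

/-! ### Circuits for products of elementary symmetric polynomials -/

/-- `p` is an input or the result of a gate of `s`. The zero polynomial, the formal `-∞`, is
admitted as well although no wire needs to carry it: adding it or multiplying by it costs no
gate. -/
def GateSeq.Provides {n k : ℕ} (s : GateSeq n k) (p : TropPoly n) : Prop :=
  p = 0 ∨ ∃ w : Wire n k, w.eval s.eval = p

/-- Some sequence of at most `k` gates provides all members of `P`. -/
def Computable {n : ℕ} (k : ℕ) (P : Set (TropPoly n)) : Prop :=
  ∃ (k' : ℕ) (s : GateSeq n k'), k' ≤ k ∧ ∀ p ∈ P, s.Provides p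

theorem GateSeq.provides_X {n k : ℕ} (s : GateSeq n k) (a : Fin n) : s.Provides (X a) :=
  Or.inr ⟨.var a, rfl⟩

theorem GateSeq.provides_one {n k : ℕ} (s : GateSeq n k) : s.Provides 1 :=
  Or.inr ⟨.const 0, by rw [Wire.eval, MaxPlus.ofReal_zero, C_1]⟩

theorem GateSeq.Provides.snoc {n k : ℕ} {s : GateSeq n k} {p : TropPoly n} (h : s.Provides p)
    (g : Gate n k) : (s.snoc g).Provides p := by
  obtain rfl | ⟨w, rfl⟩ := h
  · exact Or.inl rfl
  · right
    cases w with
    | var a => exact ⟨.var a, rfl⟩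
    | const r => exact ⟨.const r, rfl⟩
    | gate j => exact ⟨.gate j.castSucc, by simp [Wire.eval, GateSeq.eval]⟩

theorem GateSeq.snoc_provides {n k : ℕ} (s : GateSeq n k) (g : Gate n k) :
    (s.snoc g).Provides (g.eval s.eval) :=
  Or.inr ⟨.gate (Fin.last k), by simp [Wire.eval, GateSeq.eval]⟩

theorem Computable.mono {n k l : ℕ} {P Q : Set (TropPoly n)} (h : Computable k P) (hkl : k ≤ l)
    (hQ : Q ⊆ P) : Computable l Q := by
  obtain ⟨k', s, hk, hs⟩ := h
  exact ⟨k', s, hk.trans hkl, fun p hp => hs p (hQ hp)⟩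

theorem Computable.insert_one {n k : ℕ} {P : Set (TropPoly n)} (h : Computable k P) :
    Computable k (insert 1 P) := by
  obtain ⟨k', s, hk, hs⟩ := h
  refine ⟨k', s, hk, ?_⟩
  rintro p (rfl | hp)
  exacts [s.provides_one, hs p hp]

theorem Computable.insert_X {n k : ℕ} {P : Set (TropPoly n)} (h : Computable k P) (a : Fin n) :
    Computable k (insert (X a) P) := by
  obtain ⟨k', s, hk, hs⟩ := h
  refine ⟨k', s, hk, ?_⟩
  rintro p (rfl | hp)
  exacts [s.provides_X a, hs p hp]

theorem Computable.insert_zero {n k : ℕ} {P : Set (TropPoly n)} (h : Computable k P) :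
    Computable k (insert 0 P) := by
  obtain ⟨k', s, hk, hs⟩ := h
  refine ⟨k', s, hk, ?_⟩
  rintro p (rfl | hp)
  exacts [Or.inl rfl, hs p hp]

theorem Computable.insert_of_mem {n k : ℕ} {P : Set (TropPoly n)} (h : Computable k P)
    {p : TropPoly n} (hp : p ∈ P) : Computable (k + 1) (insert p P) := by
  rw [Set.insert_eq_of_mem hp]
  exact h.mono (Nat.le_succ k) subset_rfl

theorem Computable.insert_add {n k : ℕ} {P : Set (TropPoly n)} (h : Computable k P)
    {p q : TropPoly n} (hp : p ∈ P) (hq : q ∈ P) : Computable (k + 1) (insert (p + q) P) := by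
  obtain ⟨k', s, hk, hs⟩ := id h
  rcases hs p hp with rfl | ⟨v, rfl⟩
  · simpa using h.insert_of_mem hq
  rcases hs q hq with rfl | ⟨w, rfl⟩
  · simpa using h.insert_of_mem hp
  refine ⟨k' + 1, s.snoc (.add v w), by omega, ?_⟩
  rintro r (rfl | hr)
  exacts [s.snoc_provides (.add v w), (hs r hr).snoc _]

theorem Computable.insert_mul {n k : ℕ} {P : Set (TropPoly n)} (h : Computable k P)
    {p q : TropPoly n} (hp : p ∈ P) (hq : q ∈ P) : Computable (k + 1) (insert (p * q) P) := by
  obtain ⟨k', s, hk, hs⟩ := id h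
  rcases hs p hp with rfl | ⟨v, rfl⟩
  · simpa using h.insert_of_mem hp
  rcases hs q hq with rfl | ⟨w, rfl⟩
  · simpa using h.insert_of_mem hq
  refine ⟨k' + 1, s.snoc (.mul v w), by omega, ?_⟩
  rintro r (rfl | hr)
  exacts [s.snoc_provides (.mul v w), (hs r hr).snoc _]

theorem Computable.complexity_le {n k : ℕ} {P : Set (TropPoly n)} (h : Computable k P)
    {p : TropPoly n} (hp : p ∈ P) (h0 : p ≠ 0) : complexity p ≤ k := by
  obtain ⟨k', s, hk, hs⟩ := h
  obtain ⟨w, hw⟩ := (hs p hp).resolve_left h0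
  exact (iInf₂_le (⟨k', s, w⟩ : Circuit n) hw).trans (Nat.cast_le.2 hk)

/-- One step of the recursion `e_{k+1}(s ∪ {a}) = e_{k+1}(s) + x_a e_k(s)`, for all `k` at once. -/
theorem Computable.elemSymm_insert {n l : ℕ} {s : Finset (Fin n)} {a : Fin n} (ha : a ∉ s)
    (h : Computable l (Set.range (elemSymm s))) :
    Computable (l + 2 * n) (Set.range (elemSymm (insert a s))) := by
  have key : ∀ j : ℕ, Computable (l + 2 * j)
      ({p | ∃ k ≤ j, elemSymm (insert a s) k = p} ∪ insert (X a) (Set.range (elemSymm s))) := by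
    intro j
    induction j with
    | zero =>
      refine (h.insert_X a).insert_one.mono le_rfl ?_
      rintro p (⟨k, hk, rfl⟩ | hp)
      · obtain rfl := Nat.le_zero.1 hk
        exact Or.inl (elemSymm_zero _)
      · exact Or.inr hp
    | succ j ih =>
      have h1 := ih.insert_mul (p := X a) (q := elemSymm s j) (Or.inr (Or.inl rfl))
        (Or.inr (Or.inr ⟨j, rfl⟩))
      have h2 := h1.insert_add (p := elemSymm s (j + 1)) (q := X a * elemSymm s j)
        (Or.inr (Or.inr (Or.inr ⟨j + 1, rfl⟩))) (Or.inl rfl)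
      rw [← elemSymm_insert_succ ha] at h2
      refine h2.mono (by omega) ?_
      rintro p (⟨k, hk, rfl⟩ | hp)
      · rcases Nat.le_succ_iff.1 hk with hk | rfl
        · exact Or.inr (Or.inr (Or.inl ⟨k, hk, rfl⟩))
        · exact Or.inl rfl
      · exact Or.inr (Or.inr (Or.inr hp))
  refine (key n).insert_zero.mono le_rfl ?_
  rintro _ ⟨k, rfl⟩
  rcases le_or_gt k n with hk | hk
  · exact Or.inr (Or.inl ⟨k, hk, rfl⟩)
  · exact Or.inl (elemSymm_eq_zero
      ((Finset.card_le_univ _).trans_lt (by rwa [Fintype.card_fin])))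

theorem computable_elemSymm {n : ℕ} (s : Finset (Fin n)) :
    Computable (2 * n * s.card) (Set.range (elemSymm s)) := by
  induction s using Finset.induction_on with
  | empty =>
    refine ⟨0, .nil, Nat.zero_le _, ?_⟩
    rintro _ ⟨k | k, rfl⟩
    · rw [elemSymm_zero]
      exact GateSeq.provides_one _
    · exact Or.inl (elemSymm_eq_zero (by simp))
  | insert a s ha ih =>
    refine (ih.elemSymm_insert ha).mono ?_ subset_rfl
    rw [Finset.card_insert_of_notMem ha, mul_add, mul_one]

theorem Computable.insert_prod {n k : ℕ} {P : Set (TropPoly n)} (h : Computable k P)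
    {ι : Type*} (t : Finset ι) {p : ι → TropPoly n} (hp : ∀ i ∈ t, p i ∈ P) :
    Computable (k + t.card) (insert (∏ i ∈ t, p i) P) := by
  classical
  induction t using Finset.induction_on with
  | empty => simpa using h.insert_one
  | insert i t hi ih =>
    have h1 := (ih fun j hj => hp j (Finset.mem_insert_of_mem hj)).insert_mul (p := p i)
      (Or.inr (hp i (Finset.mem_insert_self i t))) (Or.inl rfl)
    rw [Finset.prod_insert hi, Finset.card_insert_of_notMem hi]
    exact h1.mono le_rfl (Set.insert_subset_insert (Set.subset_insert _ _))

theorem trop_ne_zero {n : ℕ} {f : MvPolynomial (Fin n) ℂ} (hf : f ≠ 0) : trop f ≠ 0 := by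
  classical
  obtain ⟨m, hm⟩ := support_nonempty.2 hf
  intro h
  have h1 := congrArg (coeff m) h
  simp only [trop, coeff_sum, coeff_monomial, MaxPlus.ofReal_zero, coeff_zero,
    Finset.sum_ite_eq' f.support m, if_pos hm] at h1
  exact one_ne_zero h1

theorem IsDominatedBy.complexity_trop_le {n : ℕ} {f : MvPolynomial (Fin n) ℂ}
    {lam : YoungDiagram} (hf : IsDominatedBy f lam) (h0 : f ≠ 0) :
    complexity (trop f) ≤ ((3 * (n ^ 2 * lam.rowLen 0) : ℕ) : ℕ∞) := by
  have hne := trop_ne_zero h0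
  rw [hf.trop_eq_prod] at hne ⊢
  have hcomp : Computable (3 * (n ^ 2 * lam.rowLen 0))
      {∏ j : Fin (lam.rowLen 0), elemSymm (Finset.univ : Finset (Fin n)) (lam.colLen j)} := by
    rcases Nat.eq_zero_or_pos (lam.rowLen 0) with hr | hr
    · -- The only polynomial is the empty product, which is an input.
      refine ⟨0, .nil, Nat.zero_le _, ?_⟩
      have : IsEmpty (Fin (lam.rowLen 0)) := by
        rw [hr]
        infer_instance
      rintro _ rfl
      rw [Finset.univ_eq_empty, Finset.prod_empty]
      exact GateSeq.provides_one _
    · have hn : 0 < n := by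
        rcases Nat.eq_zero_or_pos n with rfl | hn
        · obtain ⟨m, hm⟩ := support_nonempty.2 h0
          have := ((hf.coeff_ne_zero_iff m).1 (mem_support_iff.1 hm)).rowLen_eq_zero
          omega
        · exact hn
      have h1 := (computable_elemSymm (Finset.univ : Finset (Fin n))).insert_prod
        (Finset.univ : Finset (Fin (lam.rowLen 0))) (p := fun j => elemSymm _ (lam.colLen j))
        fun j _ => ⟨_, rfl⟩
      rw [Finset.card_univ, Finset.card_univ, Fintype.card_fin, Fintype.card_fin] at h1
      refine h1.mono ?_ (Set.singleton_subset_iff.2 (Or.inl rfl))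
      have h2 : n ^ 2 * 1 ≤ n ^ 2 * lam.rowLen 0 := Nat.mul_le_mul_left _ hr
      have h3 : 1 * lam.rowLen 0 ≤ n ^ 2 * lam.rowLen 0 :=
        Nat.mul_le_mul_right _ (Nat.pow_pos hn)
      have h4 : 2 * n * n = 2 * n ^ 2 := by ring
      omega
  exact hcomp.complexity_le rfl hne

end TropicalSchur
end

theorem proposition2p3 :
    (∀ (n : ℕ) (f : MvPolynomial (Fin n) ℂ) (lam : YoungDiagram),
      TropicalSchur.IsDominatedBy f lam →
        TropicalSchur.trop f = TropicalSchur.trop (TropicalSchur.schur n lam)) ∧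
    (∃ A : ℕ, ∀ (n : ℕ) (f : MvPolynomial (Fin n) ℂ) (lam : YoungDiagram),
      TropicalSchur.IsDominatedBy f lam → f ≠ 0 →
        TropicalSchur.complexity (TropicalSchur.trop f)
          ≤ ((A * (n ^ 2 * lam.rowLen 0) : ℕ) : ℕ∞)) := by
  refine ⟨fun n f lam hf => ?_, 3, fun n f lam hf h0 => hf.complexity_trop_le h0⟩
  rw [TropicalSchur.trop, TropicalSchur.trop, hf.support_eq]
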